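/- The following problem is undecidable: given a finite alphabet $\Sigma$ and a linear context-free language $L\subseteq\Sigma^*$, presented by a linear context-free grammar (a context-free grammar in which the right-hand side of every production contains at most one nonterminal), decide whether there is a word $w\in\Sigma^*$ such that $L$ contains an element of $w\mathbin{\sqcup\!\!\sqcup}w^r$. Here $w^r$ is the reversal of $w$, and the shuffle of two words $u,v\in\Sigma^*$ is $$u\mathbin{\sqcup\!\!\sqcup}v=\{u_1v_1u_2v_2\cdots u_nv_n \mid n\ge 1,\ u_i,v_i\in\Sigma^*,\ u=u_1\cdots u_n,\ v=v_1\cdots v_n\}.$$ -/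

import Mathlib

/-- The shuffle of the words `u` and `v`: all words `u₁ v₁ u₂ v₂ ⋯ uₙ vₙ` with `u = u₁ ⋯ uₙ` and
`v = v₁ ⋯ vₙ`, where the factors may be empty. The list `l` holds the pairs `(uᵢ, vᵢ)`. -/
def shuffle {α : Type*} (u v : List α) : Language α :=
  {z | ∃ l : List (List α × List α),
    u = (l.map fun p => p.1).flatten ∧
    v = (l.map fun p => p.2).flatten ∧
    z = (l.map fun p => p.1 ++ p.2).flatten}

/-- A production of a linear context-free grammar, with terminals and nonterminals named by natural
numbers: `(A, x, none)` is the production `A → x`, and `(A, x, some (B, y))` is the production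
`A → x B y`, where `x` and `y` are terminal words. -/
abbrev LinearProduction : Type := ℕ × List ℕ × Option (ℕ × List ℕ)

/-- A linear context-free grammar as a finite object (an input for an algorithm): its initial
nonterminal and the finite list of its productions. The alphabet is the finite set of the terminals
that occur in the productions. -/
abbrev LinearGrammar : Type := ℕ × List LinearProduction

namespace LinearProduction

/-- The right-hand side of a production, as a word of terminals and nonterminals. -/
def rhs (p : LinearProduction) : List (Symbol ℕ ℕ) :=
  p.2.1.map Symbol.terminal ++
    match p.2.2 with
    | none => []
    | some (B, y) => Symbol.nonterminal B :: y.map Symbol.terminal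

/-- The production as a context-free rule. -/
def toRule (p : LinearProduction) : ContextFreeRule ℕ ℕ where
  input := p.1
  output := p.rhs

end LinearProduction

namespace LinearGrammar

/-- The context-free grammar that a linear grammar is. -/
def toContextFreeGrammar (G : LinearGrammar) : ContextFreeGrammar ℕ where
  NT := ℕ
  initial := G.1
  rules := (G.2.map LinearProduction.toRule).toFinset

/-- The linear context-free language generated by a linear grammar. -/
def language (G : LinearGrammar) : Language ℕ :=
  G.toContextFreeGrammar.language

/-- One derivation step applies one of the listed productions. -/
theorem produces_iff (G : LinearGrammar) (a b : List (Symbol ℕ ℕ)) :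
    ContextFreeGrammar.Produces G.toContextFreeGrammar a b ↔
      ∃ p ∈ G.2, (LinearProduction.toRule p).Rewrites a b := by
  constructor
  · rintro ⟨r, hr, h⟩
    obtain ⟨p, hp, rfl⟩ := List.mem_map.1 (List.mem_toFinset (α := ContextFreeRule ℕ ℕ).1 hr)
    exact ⟨p, hp, h⟩
  · rintro ⟨p, hp, h⟩
    exact ⟨p.toRule, List.mem_toFinset (α := ContextFreeRule ℕ ℕ).2 (List.mem_map_of_mem hp), h⟩

end LinearGrammar

/-! ### Shuffles of a word with its reversal -/

section Shuffle

variable {α : Type*}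

/-! The halting problem reduces to this one. Two markers turn the shuffle condition into an equality
test: for `x` and `y` free of 0 and 1, the word `x 0 1 0 y 1` lies in some shuffle of `w` and its
reversal exactly when `y` is the reversal of `x` (`exists_mem_shuffle_reverse_iff`).

A linear grammar writes to the left and to the right of its nonterminal at once, so it simulates a
finite two-tape transducer: on the left a sequence `x` of machine configurations, on the right,
reversed, the sequence `y` of their successors. The start production adds the initial configuration
to the right part. The equality test then says that `x` is the initial configuration followed by
`y`, so each configuration in `x` is the successor of the previous one, until a halting state is met
(`exists_run_iff`).

The machines are stack machines with finitely many states, obtained from Mathlib's `TM2` machines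
for partial recursive functions (`exists_halts_iff_dom`). Only the start production depends on the
input, so the reduction is computable. -/

theorem nil_mem_shuffle {u v : List α} : [] ∈ shuffle u v ↔ u = [] ∧ v = [] := by
  constructor
  · rintro ⟨l, rfl, rfl, h⟩
    have h' : ∀ p ∈ l, p.1 = [] ∧ p.2 = [] := fun p hp =>
      List.append_eq_nil_iff.1 (List.flatten_eq_nil_iff.1 h.symm _ (List.mem_map_of_mem hp))
    simp only [List.flatten_eq_nil_iff, List.mem_map]
    constructor
    · rintro _ ⟨p, hp, rfl⟩
      exact (h' p hp).1
    · rintro _ ⟨p, hp, rfl⟩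
      exact (h' p hp).2
  · rintro ⟨rfl, rfl⟩
    exact ⟨[], rfl, rfl, rfl⟩

/-- Reading a shuffle letter by letter replaces the factorizations, with their possibly empty
factors, in the arguments below. -/
theorem cons_mem_shuffle {a : α} {z u v : List α} : a :: z ∈ shuffle u v ↔
    (∃ u', u = a :: u' ∧ z ∈ shuffle u' v) ∨ ∃ v', v = a :: v' ∧ z ∈ shuffle u v' := by
  constructor
  · rintro ⟨l, rfl, rfl, h⟩
    induction l with
    | nil => simp at h
    | cons p l ih =>
      obtain ⟨_ | ⟨b, s⟩, t⟩ := p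
      · cases t with
        | nil => simpa using ih (by simpa using h)
        | cons c t =>
          obtain ⟨rfl, rfl⟩ : a = c ∧ z = t ++ (l.map fun p => p.1 ++ p.2).flatten := by
            simpa using h
          exact .inr ⟨_, rfl, ([], t) :: l, by simp, by simp, by simp⟩
      · obtain ⟨rfl, rfl⟩ : a = b ∧ z = s ++ (t ++ (l.map fun p => p.1 ++ p.2).flatten) := by
          simpa using h
        exact .inl ⟨_, rfl, (s, t) :: l, by simp, by simp, by simp⟩
  · rintro (⟨u', rfl, l, rfl, rfl, rfl⟩ | ⟨v', rfl, l, rfl, rfl, rfl⟩)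
    · exact ⟨([a], []) :: l, by simp, by simp, by simp⟩
    · exact ⟨([], [a]) :: l, by simp, by simp, by simp⟩

theorem mem_shuffle_comm {z u v : List α} : z ∈ shuffle u v ↔ z ∈ shuffle v u := by
  induction z generalizing u v with
  | nil => simp [nil_mem_shuffle, and_comm]
  | cons a z ih =>
    rw [cons_mem_shuffle, cons_mem_shuffle, or_comm]
    simp only [ih]

theorem mem_shuffle_nil_left {z v : List α} : z ∈ shuffle [] v ↔ z = v := by
  induction z generalizing v with
  | nil => simp [nil_mem_shuffle, eq_comm]
  | cons a z ih => cases v <;> simp [cons_mem_shuffle, ih, eq_comm]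

theorem append_mem_shuffle {z₁ z₂ u v : List α} : z₁ ++ z₂ ∈ shuffle u v ↔
    ∃ u₁ u₂ v₁ v₂, u = u₁ ++ u₂ ∧ v = v₁ ++ v₂ ∧ z₁ ∈ shuffle u₁ v₁ ∧ z₂ ∈ shuffle u₂ v₂ := by
  constructor
  · induction z₁ generalizing u v with
    | nil => exact fun h => ⟨[], u, [], v, by simpa [nil_mem_shuffle] using h⟩
    | cons a z₁ ih =>
      rw [List.cons_append, cons_mem_shuffle]
      rintro (⟨u', rfl, h⟩ | ⟨v', rfl, h⟩)
      · obtain ⟨u₁, u₂, v₁, v₂, rfl, rfl, h₁, h₂⟩ := ih h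
        exact ⟨a :: u₁, u₂, v₁, v₂, rfl, rfl, cons_mem_shuffle.2 (.inl ⟨_, rfl, h₁⟩), h₂⟩
      · obtain ⟨u₁, u₂, v₁, v₂, rfl, rfl, h₁, h₂⟩ := ih h
        exact ⟨u₁, u₂, a :: v₁, v₂, rfl, rfl, cons_mem_shuffle.2 (.inr ⟨_, rfl, h₁⟩), h₂⟩
  · rintro ⟨u₁, u₂, v₁, v₂, rfl, rfl, ⟨l₁, rfl, rfl, rfl⟩, l₂, rfl, rfl, rfl⟩
    exact ⟨l₁ ++ l₂, by simp, by simp, by simp⟩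

theorem count_of_mem_shuffle [DecidableEq α] (a : α) {z u v : List α} (h : z ∈ shuffle u v) :
    z.count a = u.count a + v.count a := by
  induction z generalizing u v with
  | nil => obtain ⟨rfl, rfl⟩ := nil_mem_shuffle.1 h; rfl
  | cons b z ih =>
    obtain ⟨u', rfl, h'⟩ | ⟨v', rfl, h'⟩ := cons_mem_shuffle.1 h <;>
      simp only [List.count_cons, ih h'] <;> omega

/-- A word in which the marker `e` ends the word and stands in the middle between two marks `m` is
in the shuffle of a word and its reversal only if its two remaining factors are reversals of each
other. -/
theorem exists_mem_shuffle_reverse_iff [DecidableEq α] {e m : α} {x y : List α} (hem : e ≠ m)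
    (hxe : e ∉ x) (hxm : m ∉ x) (hye : e ∉ y) (hym : m ∉ y) :
    (∃ w, x ++ [m, e, m] ++ y ++ [e] ∈ shuffle w w.reverse) ↔ y = x.reverse := by
  constructor
  · rintro ⟨w, h⟩
    -- By symmetry `w` may be taken to be the factor that supplies the middle `e`. Each of the two
    -- words contains `e` exactly once, so the other one supplies the final `e`.
    have key : ∀ w v, v = w.reverse → (∃ u₁ u₂ v₁ v₂, w = u₁ ++ e :: u₂ ∧ v = v₁ ++ v₂ ∧
        x ++ [m] ∈ shuffle u₁ v₁ ∧ m :: y ++ [e] ∈ shuffle u₂ v₂) → y = x.reverse := by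
      rintro w v hv ⟨u₁, u₂, v₁, v₂, hw, rfl, h₁, h₂⟩
      have ce := (count_of_mem_shuffle e h₁).symm
      have ce' := (count_of_mem_shuffle e h₂).symm
      have cm := (count_of_mem_shuffle m h₁).symm
      have cm' := (count_of_mem_shuffle m h₂).symm
      have hve := congrArg (List.count e) hv
      have hvm := congrArg (List.count m) hv
      simp only [hw, List.count_reverse, List.count_append, List.count_cons, List.count_nil,
        List.count_eq_zero_of_not_mem hxe, List.count_eq_zero_of_not_mem hye,
        List.count_eq_zero_of_not_mem hxm, List.count_eq_zero_of_not_mem hym,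
        beq_self_eq_true, beq_iff_eq, hem, hem.symm, if_true, if_false] at ce ce' cm cm' hve hvm
      have hu₁ : e ∉ u₁ := List.count_eq_zero.1 (by omega)
      have hu₂ : e ∉ u₂ := List.count_eq_zero.1 (by omega)
      obtain ⟨u₃, u₄, v₃, v₄, rfl, rfl, h₃, h₄⟩ := append_mem_shuffle.1 h₂
      rcases cons_mem_shuffle.1 h₄ with ⟨u, rfl, -⟩ | ⟨v, rfl, h₅⟩
      · simp at hu₂
      obtain ⟨rfl, rfl⟩ := nil_mem_shuffle.1 h₅
      rw [hw] at hv
      -- The reversal ends in `e`, so `w` begins with `e`; since `e ∉ u₁`, the prefix `u₁` is empty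
      -- and `x ++ [m]` comes entirely from the reversal.
      cases u₁ with
      | cons b u₁ =>
        have := congrArg List.reverse hv
        simp only [List.reverse_append, List.reverse_reverse, List.reverse_singleton,
          List.cons_append, List.cons.injEq] at this
        simp [this.1] at hu₁
      | nil =>
        obtain rfl := mem_shuffle_nil_left.1 h₁
        have hu : u₃ = v₃.reverse ++ m :: x.reverse := by
          have := congrArg List.reverse hv
          simpa using this.symm
        simp only [hu, List.count_reverse, List.count_append, List.count_cons, List.count_nil,
          beq_self_eq_true, if_true, List.count_eq_zero_of_not_mem hxm] at cm'
        have hv₃ : m ∉ v₃ := List.count_eq_zero.1 (by omega)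
        -- Now `m ∉ v₃`, so the second `m` is the first letter of `u₃ = v₃.reverse ++ m ::
        -- x.reverse`. This forces `v₃ = []`, and `y` is all that remains of `u₃`.
        rcases cons_mem_shuffle.1 h₃ with ⟨u, rfl, h₆⟩ | ⟨v, rfl, h₆⟩
        · rcases List.eq_nil_or_concat v₃ with rfl | ⟨v, b, rfl⟩
          · obtain rfl : u = x.reverse := by simpa using hu
            exact mem_shuffle_nil_left.1 (mem_shuffle_comm.1 h₆)
          · simp at hu
            simp [hu.1] at hv₃
        · simp at hv₃
    rw [show x ++ [m, e, m] ++ y ++ [e] = (x ++ [m]) ++ e :: (m :: y ++ [e]) by simp] at h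
    obtain ⟨u₁, u₂, v₁, v₂, hu, hv, h₁, h₂⟩ := append_mem_shuffle.1 h
    rcases cons_mem_shuffle.1 h₂ with ⟨u, rfl, h₃⟩ | ⟨v, rfl, h₃⟩
    · exact key _ _ rfl ⟨u₁, u, v₁, v₂, hu, hv, h₁, h₃⟩
    · exact key w.reverse w (by simp)
        ⟨v₁, v, u₁, u₂, hv, hu, mem_shuffle_comm.1 h₁, mem_shuffle_comm.1 h₃⟩
  · rintro rfl
    exact ⟨e :: m :: x.reverse, [([], x ++ [m]), (e :: m :: x.reverse, [e])],
      by simp, by simp, by simp⟩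

end Shuffle

/-! ### Derivations in linear grammars -/

namespace LinearGrammar

/-- The words that the nonterminal `A` derives with the linear productions `R`. -/
inductive Derivable (R : List LinearProduction) : ℕ → List ℕ → Prop
  | last {A x} : (A, x, none) ∈ R → Derivable R A x
  | wrap {A x B y m} : (A, x, some (B, y)) ∈ R → Derivable R B m → Derivable R A (x ++ m ++ y)

theorem produces_of_mem {G : LinearGrammar} {P : LinearProduction} (h : P ∈ G.2) :
    ContextFreeGrammar.Produces G.toContextFreeGrammar [Symbol.nonterminal P.1] P.rhs :=
  (produces_iff G _ _).2 ⟨P, h,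
    ContextFreeRule.rewrites_iff.2 ⟨[], [], rfl, (List.append_nil _).symm⟩⟩

theorem Derivable.derives {G : LinearGrammar} {A : ℕ} {z : List ℕ} (h : Derivable G.2 A z) :
    Relation.ReflTransGen (ContextFreeGrammar.Produces G.toContextFreeGrammar)
      [Symbol.nonterminal A] (z.map Symbol.terminal) := by
  induction h with
  | @last A x h =>
    have hx : LinearProduction.rhs (A, x, none) = x.map Symbol.terminal := List.append_nil _
    exact .single (hx ▸ produces_of_mem h)
  | @wrap A x B y m h _ ih =>
    have hd := (ContextFreeGrammar.Derives.append_left ih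
      (x.map Symbol.terminal)).append_right (y.map Symbol.terminal)
    have hx : LinearProduction.rhs (A, x, some (B, y)) =
        x.map Symbol.terminal ++ [Symbol.nonterminal B] ++ y.map Symbol.terminal := by
      simp [LinearProduction.rhs]
    simp only [List.map_append]
    exact hd.head (hx ▸ produces_of_mem h)

theorem eq_of_append_nonterminal_eq {p : List ℕ} {A B : ℕ} {s : List ℕ}
    {p' s' : List (Symbol ℕ ℕ)}
    (h : p.map Symbol.terminal ++ Symbol.nonterminal A :: s.map Symbol.terminal =
      p' ++ [Symbol.nonterminal B] ++ s') :
    p' = p.map Symbol.terminal ∧ A = B ∧ s' = s.map Symbol.terminal := by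
  induction p generalizing p' with
  | nil =>
    cases p' with
    | nil => simpa [eq_comm] using h
    | cons c p' =>
      have hm : Symbol.nonterminal B ∈ s.map (Symbol.terminal (N := ℕ)) := by
        simp at h
        simp [h.2]
      simp at hm
  | cons a p ih =>
    cases p' with
    | nil => simp at h
    | cons c p' =>
      simp only [List.map_cons, List.cons_append, List.cons.injEq] at h
      obtain ⟨rfl, h⟩ := h
      obtain ⟨rfl, rfl, rfl⟩ := ih h
      simp

/-- A sentential form of a linear grammar has at most one nonterminal. Both shapes are treated in
one induction, because a terminating production leads from the second to the first. -/
theorem derivable_of_derives {G : LinearGrammar} {z : List ℕ} {v : List (Symbol ℕ ℕ)}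
    (h : Relation.ReflTransGen (ContextFreeGrammar.Produces G.toContextFreeGrammar) v
      (z.map Symbol.terminal)) :
    (∀ p : List ℕ, v = p.map Symbol.terminal → z = p) ∧
    ∀ (p : List ℕ) (A : ℕ) (s : List ℕ),
      v = p.map Symbol.terminal ++ Symbol.nonterminal A :: s.map Symbol.terminal →
      ∃ m, Derivable G.2 A m ∧ z = p ++ m ++ s := by
  have hinj : Function.Injective (List.map (Symbol.terminal (T := ℕ) (N := ℕ))) :=
    List.map_injective_iff.2 fun _ _ h => by simpa using h
  induction h using Relation.ReflTransGen.head_induction_on with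
  | refl =>
    refine ⟨fun p hp => hinj hp, fun p A s hp => ?_⟩
    have hm : Symbol.nonterminal A ∈ z.map (Symbol.terminal (N := ℕ)) :=
      hp.symm ▸ List.mem_append_right _ List.mem_cons_self
    exact absurd hm (by simp)
  | @head a b hab _ ih =>
    obtain ⟨P, hP, hr⟩ := (produces_iff G _ _).1 hab
    obtain ⟨p', s', rfl, rfl⟩ := ContextFreeRule.rewrites_iff.1 hr
    refine ⟨fun p hp => ?_, fun p A s hp => ?_⟩
    · have hm : Symbol.nonterminal P.toRule.input ∈ p.map (Symbol.terminal (N := ℕ)) := by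
        rw [← hp]; simp
      simp at hm
    · obtain ⟨rfl, hA, rfl⟩ := eq_of_append_nonterminal_eq hp.symm
      obtain ⟨A', x, _ | ⟨B, y⟩⟩ := P
      · obtain rfl : A = A' := hA
        exact ⟨x, .last hP, ih.1 (p ++ x ++ s)
          (by simp [LinearProduction.toRule, LinearProduction.rhs])⟩
      · obtain rfl : A = A' := hA
        obtain ⟨m, hm, rfl⟩ := ih.2 (p ++ x) B (y ++ s)
          (by simp [LinearProduction.toRule, LinearProduction.rhs])
        exact ⟨_, .wrap hP hm, by simp⟩

theorem mem_language_iff (G : LinearGrammar) (z : List ℕ) :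
    z ∈ G.language ↔ Derivable G.2 G.1 z := by
  constructor
  · intro h
    obtain ⟨m, hm, rfl⟩ := (derivable_of_derives h).2 [] G.1 [] rfl
    simpa using hm
  · exact fun h => h.derives

end LinearGrammar

/-! ### Stack machines and their configurations as words -/

open Function

/-- A machine with stacks indexed by `K` over the alphabet `Γ`: in the state `q` it halts if `op q`
is `none`; otherwise `op q = some (k, f)`, and the machine pops the top of the stack `k` (`none` if
the stack is empty), and `f` gives its new state and the word to push. -/
structure StackMachine (Q K Γ : Type) where
  op : Q → Option (K × (Option Γ → Q × List Γ))

namespace StackMachine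

variable {Q K Γ : Type} (M : StackMachine Q K Γ)

inductive Halts [DecidableEq K] : Q → (K → List Γ) → Prop
  | halt {q S} : M.op q = none → Halts q S
  | step {q S k f} : M.op q = some (k, f) →
      Halts (f (S k).head?).1 (update S k ((f (S k).head?).2 ++ (S k).tail)) → Halts q S

/-- The cells that replace the top cell `(k, t)` when `w` is pushed. -/
def cells (k : K) (w : List Γ) : Option Γ → List (K × Option Γ)
  | some _ => w.map fun g => (k, some g)
  | none => (w.map fun g => (k, some g)) ++ [(k, none)]

/-- The word `u` holds the cells of all stacks, tagged by their stack and in any order between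
different stacks, with a bottom cell `(k, none)` for each stack. -/
def Represents [DecidableEq K] (u : List (K × Option Γ)) (S : K → List Γ) : Prop :=
  ∀ k, u.filter (fun c => c.1 = k) = (S k).map (fun g => (k, some g)) ++ [(k, none)]

/-- Storing all stacks in one word makes a step local: only the first cell tagged `k` is rewritten.
The bottom cells make emptiness of a stack visible in the same way. -/
inductive WordHalts : Q → List (K × Option Γ) → Prop
  | halt {q u} : M.op q = none → WordHalts q u
  | step {q k f a t b} : M.op q = some (k, f) → (∀ c ∈ a, c.1 ≠ k) →
      WordHalts (f t).1 (a ++ cells k (f t).2 t ++ b) → WordHalts q (a ++ (k, t) :: b)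

section

variable [DecidableEq K]

theorem Represents.exists_top {u : List (K × Option Γ)} {S : K → List Γ} (h : Represents u S)
    (k : K) : ∃ a b, (∀ c ∈ a, c.1 ≠ k) ∧ u = a ++ (k, (S k).head?) :: b := by
  obtain ⟨l, hl⟩ : ∃ l, u.filter (fun c => c.1 = k) = (k, (S k).head?) :: l := by
    rw [h k]
    cases S k <;> simp
  obtain ⟨a, b, rfl, ha, -⟩ := List.filter_eq_cons_iff.1 hl
  exact ⟨a, b, by simpa using ha, rfl⟩

theorem filter_cells (k k' : K) (w : List Γ) (t : Option Γ) :
    (cells k w t).filter (fun c => c.1 = k') = if k = k' then cells k w t else [] := by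
  split_ifs with h <;> cases t <;> simp [cells, h, List.filter_eq_self]

theorem Represents.update {a b : List (K × Option Γ)} {k : K} {t : Option Γ} {S : K → List Γ}
    (h : Represents (a ++ (k, t) :: b) S) (ha : ∀ c ∈ a, c.1 ≠ k) :
    t = (S k).head? ∧
    ∀ w, Represents (a ++ cells k w t ++ b) (update S k (w ++ (S k).tail)) := by
  have ha' : a.filter (fun c => c.1 = k) = [] := by simpa [List.filter_eq_nil_iff] using ha
  have hk := h k
  simp only [List.filter_append, ha', List.nil_append, decide_true, List.filter_cons_of_pos] at hk
  cases hS : S k with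
  | nil =>
    simp only [hS, List.map_nil, List.nil_append, List.cons.injEq, Prod.mk.injEq, true_and] at hk
    obtain ⟨rfl, hb⟩ := hk
    refine ⟨rfl, fun w k' => ?_⟩
    rw [List.filter_append, List.filter_append, filter_cells]
    by_cases hkk : k = k'
    · subst hkk
      simp [ha', hb, cells]
    · simpa [hkk, Ne.symm hkk] using h k'
  | cons g s =>
    simp only [hS, List.map_cons, List.cons_append, List.cons.injEq, Prod.mk.injEq, true_and] at hk
    obtain ⟨rfl, hb⟩ := hk
    refine ⟨rfl, fun w k' => ?_⟩
    rw [List.filter_append, List.filter_append, filter_cells]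
    by_cases hkk : k = k'
    · subst hkk
      simp [ha', hb, cells]
    · simpa [hkk, Ne.symm hkk] using h k'

theorem wordHalts_iff_halts {q : Q} {u : List (K × Option Γ)} {S : K → List Γ}
    (h : Represents u S) : M.WordHalts q u ↔ M.Halts q S := by
  constructor
  · intro hu
    induction hu generalizing S with
    | halt hq => exact .halt hq
    | step hq ha _ ih =>
      obtain ⟨rfl, hr⟩ := h.update ha
      exact .step hq (ih (hr _))
  · intro hS
    induction hS generalizing u with
    | halt hq => exact .halt hq
    | @step q S k f hq _ ih =>
      obtain ⟨a, b, ha, rfl⟩ := h.exists_top k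
      exact .step hq ha (ih ((h.update ha).2 _))

end

/-! ### Comparing configurations with their successors -/

/-- The letters of the words that record computations: states, cells, and a separator. -/
inductive Letter (Q K Γ : Type)
  | state (q : Q)
  | cell (c : K × Option Γ)
  | sep

/-- The nonterminals of the grammar that compares a sequence of configurations with the sequence of
their successors. -/
inductive Phase (Q Γ : Type)
  | main
  | scan (q : Q) (t : Option Γ)
  | copy
  | drain

open Letter Phase

/-- `M.Edge p x y p'`: the grammar may pass from the phase `p` to `p'`, extending the sequence of
configurations by `x` and the sequence of their successors by `y`. -/
inductive Edge : Phase Q Γ → List (Letter Q K Γ) → List (Letter Q K Γ) → Phase Q Γ → Prop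
  | dispatch {q k f} (t) : M.op q = some (k, f) →
      Edge main [state q] [state (f t).1] (scan q t)
  | scan {q k f t c} : M.op q = some (k, f) → c.1 ≠ k →
      Edge (scan q t) [cell c] [cell c] (scan q t)
  | apply {q k f t} : M.op q = some (k, f) →
      Edge (scan q t) [cell (k, t)] ((cells k (f t).2 t).map cell) copy
  | copy (c) : Edge copy [cell c] [cell c] copy
  | sep : Edge copy [sep] [sep] main
  | halt {q} : M.op q = none → Edge main [state q] [] drain
  | drain (s) : Edge drain [s] [] drain

/-- A run ends only in `drain`, which is entered from `main` only at a halting state. The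
successor's state is written before the popped cell is read, so `dispatch` guesses `t` and `apply`
checks the guess. -/
inductive Run : Phase Q Γ → List (Letter Q K Γ) → List (Letter Q K Γ) → Prop
  | nil : Run drain [] []
  | cons {p x y p' x' y'} : M.Edge p x y p' → Run p' x' y' → Run p (x ++ x') (y ++ y')

theorem finite_setOf_edge [Finite Q] [Finite K] [Finite Γ] :
    {e : Phase Q Γ × List (Letter Q K Γ) × List (Letter Q K Γ) × Phase Q Γ |
      M.Edge e.1 e.2.1 e.2.2.1 e.2.2.2}.Finite := by
  refine Set.Finite.subset (s :=
    Set.range (fun i : Q × Q × Option Γ =>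
      (main, [state i.1], [state i.2.1], Phase.scan i.1 i.2.2)) ∪
    Set.range (fun i : Q × Option Γ × (K × Option Γ) =>
      (Phase.scan i.1 i.2.1, [cell i.2.2], [cell i.2.2], Phase.scan i.1 i.2.1)) ∪
    Set.range (fun i : Q × K × Option Γ => (Phase.scan i.1 i.2.2, [cell i.2],
      -- The default `[]` concerns only halting states, which have no `apply` edge; it merely
      -- enlarges the finite superset.
      (cells i.2.1 (((M.op i.1).map fun o => (o.2 i.2.2).2).getD []) i.2.2).map cell,
      Phase.copy)) ∪
    Set.range (fun c : K × Option Γ => (Phase.copy, [cell c], [cell c], Phase.copy)) ∪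
    {(Phase.copy, [Letter.sep], [Letter.sep], main)} ∪
    Set.range (fun q : Q => (main, [state q], [], Phase.drain)) ∪
    Set.range (fun q : Q => (Phase.drain, [state q], [], Phase.drain)) ∪
    Set.range (fun c : K × Option Γ => (Phase.drain, [cell c], [], Phase.drain)) ∪
    {(Phase.drain, [Letter.sep], [], Phase.drain)}) ?_ ?_
  · simp only [Set.finite_union, Set.finite_range, Set.finite_singleton, and_true]
  · rintro ⟨p, x, y, p'⟩ h
    cases (show M.Edge p x y p' from h) with
    | drain s => cases s <;> simp
    | apply hq => simp [hq]
    | _ => simp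

/-- The invariant of the equation `x = start ++ sep :: y` along a run. In `scan` and `copy`, `b` is
the unread rest of the current configuration and `a` the part of its successor already written; in
`scan`, `a` is still an unchanged prefix of the current configuration. -/
theorem Run.wordHalts {p : Phase Q Γ} {x y : List (Letter Q K Γ)} (h : M.Run p x y) :
    match p with
    | main => ∀ q u, x = state q :: u.map cell ++ sep :: y → M.WordHalts q u
    | scan q t => ∀ k f, M.op q = some (k, f) → ∀ a b, (∀ c ∈ a, c.1 ≠ k) →
        x = b.map cell ++ sep :: state (f t).1 :: a.map cell ++ y → M.WordHalts q (a ++ b)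
    | copy => ∀ q a b, x = b.map cell ++ sep :: state q :: a.map cell ++ y →
        M.WordHalts q (a ++ b)
    | drain => True := by
  induction h with
  | nil => trivial
  | @cons p x y p' x' y' e _ ih =>
    cases e with
    | @dispatch q k f t hq =>
      intro q' u hx
      simp only [List.cons_append, List.nil_append, List.cons.injEq, state.injEq] at hx
      obtain ⟨rfl, hx⟩ := hx
      simpa using ih k f hq [] u (by simp) (by simpa using hx)
    | @scan q k f t c hq hc =>
      intro k' f' hq' a b ha hx
      obtain ⟨rfl, rfl⟩ : k = k' ∧ f = f' := by simpa [hq] using hq'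
      cases b with
      | nil => simp at hx
      | cons c' b =>
        simp only [List.map_cons, List.cons_append, List.nil_append, List.cons.injEq,
          cell.injEq] at hx
        obtain ⟨rfl, hx⟩ := hx
        have := ih k f hq (a ++ [c]) b
          (by simpa [or_imp, forall_and] using ⟨fun x y h => ha (x, y) h, hc⟩)
          (by simpa using hx)
        simpa using this
    | @apply q k f t hq =>
      intro k' f' hq' a b ha hx
      obtain ⟨rfl, rfl⟩ : k = k' ∧ f = f' := by simpa [hq] using hq'
      cases b with
      | nil => simp at hx
      | cons c' b =>
        simp only [List.map_cons, List.cons_append, List.nil_append, List.cons.injEq,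
          cell.injEq] at hx
        obtain ⟨rfl, hx⟩ := hx
        exact .step hq ha (ih _ _ _ (by simpa using hx))
    | copy c =>
      intro q a b hx
      cases b with
      | nil => simp at hx
      | cons c' b =>
        simp only [List.map_cons, List.cons_append, List.nil_append, List.cons.injEq,
          cell.injEq] at hx
        obtain ⟨rfl, hx⟩ := hx
        simpa using ih q (a ++ [c]) b (by simpa using hx)
    | sep =>
      intro q a b hx
      cases b with
      | nil => simpa using ih q a (by simpa using hx)
      | cons c' b => simp at hx
    | halt hq =>
      intro q' u hx
      simp only [List.cons_append, List.nil_append, List.cons.injEq, state.injEq] at hx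
      exact .halt (hx.1 ▸ hq)
    | drain s => trivial

theorem run_drain (x : List (Letter Q K Γ)) : M.Run drain x [] := by
  induction x with
  | nil => exact .nil
  | cons s x ih => exact .cons (.drain s) ih

theorem Run.copy_cells {x y : List (Letter Q K Γ)} (h : M.Run main x y)
    (b : List (K × Option Γ)) :
    M.Run copy (b.map cell ++ Letter.sep :: x) (b.map cell ++ Letter.sep :: y) := by
  induction b with
  | nil =>
    have := Run.cons .sep h
    exact this
  | cons c b ih =>
    have := Run.cons (.copy c) ih
    exact this

theorem Run.scan_cells {q : Q} {k : K} {f : Option Γ → Q × List Γ} {t : Option Γ}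
    {x y : List (Letter Q K Γ)} (h : M.Run (scan q t) x y) (hq : M.op q = some (k, f))
    {a : List (K × Option Γ)} (ha : ∀ c ∈ a, c.1 ≠ k) :
    M.Run (scan q t) (a.map cell ++ x) (a.map cell ++ y) := by
  induction a with
  | nil => exact h
  | cons c a ih =>
    have := Run.cons (.scan hq (ha c (by simp))) (ih fun c hc => ha c (by simp [hc]))
    exact this

/-- Built backwards from the halting configuration, which has no successor and is consumed by
`drain` with `y = []`. -/
theorem WordHalts.exists_run {q : Q} {u : List (K × Option Γ)} (h : M.WordHalts q u) :
    ∃ y, M.Run main (state q :: u.map cell ++ Letter.sep :: y) y := by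
  induction h with
  | @halt q u hq => exact ⟨[], .cons (.halt hq) (M.run_drain _)⟩
  | @step q k f a t b hq ha _ ih =>
    obtain ⟨y, hy⟩ := ih
    have h₁ := Run.cons (.apply (t := t) hq) (Run.copy_cells M hy b)
    have h₂ := Run.cons (.dispatch t hq) (Run.scan_cells M h₁ hq ha)
    exact ⟨_, by simpa using h₂⟩

theorem exists_run_iff {q : Q} {u : List (K × Option Γ)} :
    (∃ y, M.Run main (state q :: u.map cell ++ Letter.sep :: y) y) ↔ M.WordHalts q u :=
  ⟨fun ⟨_, h⟩ => Run.wordHalts M h q u rfl, WordHalts.exists_run M⟩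

end StackMachine

/-! ### Finite stack machines for partial recursive functions -/

namespace StackMachine

section Restrict

variable {Q K Γ : Type} (M : StackMachine Q K Γ) (T : Set Q)

open Classical in
/-- The machine `M` with its states restricted to `T`. -/
noncomputable def restrict : StackMachine T K Γ where
  op q := (M.op q).map fun o =>
    -- The fallback state `q` is never used when `T` is closed under the steps of `M`.
    (o.1, fun t => (if h : (o.2 t).1 ∈ T then ⟨(o.2 t).1, h⟩ else q, (o.2 t).2))

theorem restrict_halts_iff [DecidableEq K]
    (hT : ∀ q ∈ T, ∀ k f, M.op q = some (k, f) → ∀ t, (f t).1 ∈ T) {q : Q} (hq : q ∈ T)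
    {S : K → List Γ} : (M.restrict T).Halts ⟨q, hq⟩ S ↔ M.Halts q S := by
  constructor
  · suffices ∀ q : T, (M.restrict T).Halts q S → M.Halts q S from this ⟨q, hq⟩
    clear hq q
    intro q h
    induction h with
    | halt h => exact .halt (by simpa [restrict] using h)
    | @step q S k f h _ ih =>
      obtain ⟨⟨k', f'⟩, hf, ho⟩ := Option.map_eq_some_iff.1 h
      obtain ⟨rfl, rfl⟩ := Prod.mk.injEq .. ▸ ho
      refine .step hf ?_
      simpa [hT q q.2 _ _ hf] using ih
  · intro h
    induction h with
    | halt h => exact .halt (by simpa [restrict] using h)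
    | @step q S k f h _ ih =>
      refine .step (k := k) (by simp only [restrict, h]; rfl) ?_
      have := ih (hT q hq k f h _)
      simpa [hT q hq k f h] using this

end Restrict

section TM2

open Turing TM2 StateTransition

variable {K Γ Λ σ : Type} [Inhabited K]

/-- The stack machine that executes a machine of type `TM2` statement by statement. -/
def ofTM2 (M : Λ → Stmt (fun _ : K => Γ) Λ σ) :
    StackMachine (Stmt (fun _ : K => Γ) Λ σ × σ) K Γ where
  op
    | (.push k f q, v) => some (k, fun t => ((q, v), f v :: t.toList))
    | (.peek k f q, v) => some (k, fun t => ((q, f v t), t.toList))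
    | (.pop k f q, v) => some (k, fun t => ((q, f v t), []))
    | (.load f q, v) => some (default, fun t => ((q, f v), t.toList))
    | (.branch f q₁ q₂, v) => some (default, fun t => ((cond (f v) q₁ q₂, v), t.toList))
    | (.goto f, v) => some (default, fun t => ((M (f v), v), t.toList))
    | (.halt, _) => none

theorem toList_head?_append_tail (l : List Γ) : l.head?.toList ++ l.tail = l := by
  cases l <;> rfl

/-- The type of statements is infinite, but those occurring in a supported program form a finite
set, to which the states can be restricted. -/
theorem stmts_closed [Inhabited Λ] (M : Λ → Stmt (fun _ : K => Γ) Λ σ) {L : Finset Λ} (hL : Supports M L)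
    {p : Stmt (fun _ : K => Γ) Λ σ × σ} (hp : some p.1 ∈ stmts M L) {k : K}
    {f : Option Γ → (Stmt (fun _ : K => Γ) Λ σ × σ) × List Γ}
    (h : (ofTM2 M).op p = some (k, f)) (t : Option Γ) : some (f t).1.1 ∈ stmts M L := by
  obtain ⟨q, v⟩ := p
  cases q with
  | halt => simp [ofTM2] at h
  | goto l =>
    obtain ⟨rfl, rfl⟩ : _ = k ∧ _ = f := by simpa [ofTM2] using h
    have hl : l v ∈ L := stmts_supportsStmt hL hp v
    simpa [stmts] using ⟨l v, hl, stmts₁_self⟩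
  | branch g q₁ q₂ =>
    obtain ⟨rfl, rfl⟩ : _ = k ∧ _ = f := by simpa [ofTM2] using h
    refine stmts_trans ?_ hp
    cases hg : g v <;> simp [stmts₁, stmts₁_self]
  | _ =>
    obtain ⟨rfl, rfl⟩ : _ = k ∧ _ = f := by simpa [ofTM2] using h
    exact stmts_trans (by simp [stmts₁, stmts₁_self]) hp

variable [DecidableEq K] (M : Λ → Stmt (fun _ : K => Γ) Λ σ)

theorem eval_dom_of_halts {p : Stmt (fun _ : K => Γ) Λ σ × σ} {S : K → List Γ}
    (h : (ofTM2 M).Halts p S) : (eval (TM2.step M) (stepAux p.1 p.2 S)).Dom := by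
  induction h with
  | @halt p S h =>
    obtain ⟨q, v⟩ := p
    cases q with
    | halt => exact Part.dom_iff_mem.2 ⟨_, mem_eval.2 ⟨.refl, rfl⟩⟩
    | _ => simp [ofTM2] at h
  | @step p S k f h _ ih =>
    obtain ⟨q, v⟩ := p
    cases q with
    | halt => simp [ofTM2] at h
    | goto l =>
      obtain ⟨rfl, rfl⟩ : _ = k ∧ _ = f := by simpa [ofTM2] using h
      simp only [toList_head?_append_tail, update_eq_self] at ih
      have hr : Reaches (TM2.step M) ⟨some (l v), v, S⟩ (stepAux (M (l v)) v S) := .single rfl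
      exact (reaches_eval hr).symm ▸ ih
    | branch g q₁ q₂ =>
      obtain ⟨rfl, rfl⟩ : _ = k ∧ _ = f := by simpa [ofTM2] using h
      simp only [toList_head?_append_tail, update_eq_self] at ih
      rw [stepAux]
      cases hg : g v <;> simpa [hg] using ih
    | _ =>
      obtain ⟨rfl, rfl⟩ : _ = k ∧ _ = f := by simpa [ofTM2] using h
      simpa [toList_head?_append_tail, update_eq_self] using ih

/-- One `TM2` step runs a whole statement up to `goto` or `halt`, while the stack machine takes one
step per constructor; hence the induction on the statement. -/
theorem halts_of_stepAux {q : Stmt (fun _ : K => Γ) Λ σ} {v : σ} {S : K → List Γ}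
    (h : ∀ l v' S', stepAux q v S = ⟨some l, v', S'⟩ → (ofTM2 M).Halts (M l, v') S') :
    (ofTM2 M).Halts (q, v) S := by
  induction q generalizing v S with
  | halt => exact .halt rfl
  | goto l =>
    refine .step rfl ?_
    simpa [toList_head?_append_tail, update_eq_self] using h (l v) v S rfl
  | branch g q₁ q₂ ih₁ ih₂ =>
    refine .step rfl ?_
    simp only [toList_head?_append_tail, update_eq_self]
    rw [stepAux] at h
    cases hg : g v
    · exact ih₂ (by simpa [hg] using h)
    · exact ih₁ (by simpa [hg] using h)
  | push k f q ih | peek k f q ih | pop k f q ih | load f q ih =>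
    refine .step rfl ?_
    simp only [toList_head?_append_tail, update_eq_self, List.cons_append, List.nil_append]
    exact ih h

theorem halts_of_eval_dom {l : Λ} {v : σ} {S : K → List Γ}
    (h : (eval (TM2.step M) ⟨some l, v, S⟩).Dom) : (ofTM2 M).Halts (M l, v) S := by
  obtain ⟨d, hd⟩ := Part.dom_iff_mem.1 h
  obtain ⟨hr, hn⟩ := mem_eval.1 hd
  suffices ∀ c : Cfg (fun _ : K => Γ) Λ σ, Reaches (TM2.step M) c d →
      ∀ l v S, c = ⟨some l, v, S⟩ → (ofTM2 M).Halts (M l, v) S from this _ hr l v S rfl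
  intro c hc
  induction hc using Relation.ReflTransGen.head_induction_on with
  | refl =>
    rintro l v S rfl
    simp [TM2.step] at hn
  | @head a b hab _ ih =>
    rintro l v S rfl
    obtain rfl : stepAux (M l) v S = b := by simpa [TM2.step] using hab
    exact halts_of_stepAux M ih

theorem halts_ofTM2_iff {l : Λ} {v : σ} {S : K → List Γ} :
    (ofTM2 M).Halts (M l, v) S ↔ (eval (TM2.step M) ⟨some l, v, S⟩).Dom := by
  refine ⟨fun h => ?_, halts_of_eval_dom M⟩
  have hr : Reaches (TM2.step M) ⟨some l, v, S⟩ (stepAux (M l) v S) := .single rfl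
  exact (reaches_eval hr).symm ▸ eval_dom_of_halts M h

theorem exists_halts_iff_eval_dom [Inhabited Λ] [Finite σ] {L : Finset Λ} (hL : Supports M L)
    {l : Λ} (hl : l ∈ L) (v : σ) : ∃ (Q : Type) (_ : Finite Q) (N : StackMachine Q K Γ) (q : Q),
      ∀ S, N.Halts q S ↔ (eval (TM2.step M) ⟨some l, v, S⟩).Dom := by
  let T : Set (Stmt (fun _ : K => Γ) Λ σ × σ) := {p | some p.1 ∈ stmts M L}
  have hT : T.Finite := by
    refine Set.Finite.subset (.prod (.preimage (Option.some_injective _).injOn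
      (Finset.finite_toSet (stmts M L))) Set.finite_univ) (t := T) fun p hp => ⟨hp, trivial⟩
  have hq : (M l, v) ∈ T := by
    simp only [T, stmts, Set.mem_ofPred_eq, Finset.some_mem_insertNone, Finset.mem_biUnion]
    exact ⟨l, hl, stmts₁_self⟩
  refine ⟨T, hT, (ofTM2 M).restrict T, ⟨_, hq⟩, fun S => ?_⟩
  exact (restrict_halts_iff _ T (fun q hq k f h t => stmts_closed M hL hq h t) hq).trans
    (halts_ofTM2_iff M)

end TM2

instance finite_stackIndex : Finite Turing.PartrecToTM2.K' :=
  .of_surjective (fun i : Fin 4 => ![.main, .rev, .aux, .stack] i) fun k => by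
    cases k
    exacts [⟨0, rfl⟩, ⟨1, rfl⟩, ⟨2, rfl⟩, ⟨3, rfl⟩]

open Turing.PartrecToTM2 in
theorem exists_halts_iff_dom {f : ℕ →. ℕ} (hf : Partrec f) :
    ∃ (Q : Type) (_ : Finite Q) (M : StackMachine Q K' Γ') (q : Q),
      ∀ n, M.Halts q (K'.elim (trList [n]) [] [] []) ↔ (f n).Dom := by
  obtain ⟨c, hc⟩ := Turing.ToPartrec.Code.exists_code (Nat.Partrec'.part_iff₁.2 hf)
  -- `Supports` requires the default label in the support, so the start label is made the default.
  let : Inhabited Λ' := ⟨trNormal c .halt⟩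
  have hL : Turing.TM2.Supports tr (codeSupp c .halt) := tr_supports c .halt
  obtain ⟨Q, hQ, M, q, h⟩ := exists_halts_iff_eval_dom tr hL hL.1 (none : Option Γ')
  refine ⟨Q, hQ, M, q, fun n => (h _).trans ?_⟩
  have he := tr_eval c [n]
  rw [show c.eval [n] = pure <$> f n from hc (n ::ᵥ .nil)] at he
  exact (congrArg Part.Dom he).to_iff

end StackMachine

/-! ### Primitive recursive encoding of the input -/

namespace StackMachine

/-- The binary successor, least significant digit first. -/
def succBits : List Bool → List Bool
  | [] => [true]
  | false :: l => true :: l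
  | true :: l => false :: succBits l

/-- The binary digits of a number, least significant digit first. -/
def bits : ℕ → List Bool
  | 0 => []
  | n + 1 => succBits (bits n)

theorem primrec_succBits : Primrec succBits := by
  have h : Primrec fun l : List Bool => (List.rec [true]
      (fun b t ih => bif b then false :: ih else true :: t) l : List Bool) :=
    Primrec.list_rec (f := fun l : List Bool => l) (g := fun _ => [true])
      (h := fun _ p => bif p.1 then false :: p.2.2 else true :: p.2.1)
      .id (.const _) (Primrec.cond (Primrec.fst.comp .snd)
        (Primrec.list_cons.comp (.const _) (Primrec.snd.comp (Primrec.snd.comp .snd)))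
        (Primrec.list_cons.comp (.const _) (Primrec.fst.comp (Primrec.snd.comp .snd))))
  refine h.of_eq fun l => ?_
  induction l with
  | nil => rfl
  | cons b l ih => cases b <;> simp_all [succBits]

theorem primrec_bits : Primrec bits := by
  have h : Primrec fun n : ℕ => (Nat.rec [] (fun _ ih => succBits ih) n : List Bool) :=
    Primrec.nat_rec₁ _ (primrec_succBits.comp Primrec.snd).to₂
  refine h.of_eq fun n => ?_
  induction n with
  | zero => rfl
  | succ n ih => simp_all [bits]

open Turing.PartrecToTM2 in
theorem trNat_eq_map_bits (n : ℕ) :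
    trNat n = (bits n).map fun b => cond b Γ'.bit1 Γ'.bit0 := by
  -- Binary successor on `PosNum` agrees with `succBits` on digit lists, so iterating `succBits`
  -- yields the input encoding.
  have hp : ∀ (m : PosNum) (l : List Bool),
      trPosNum m = l.map (fun b => cond b Γ'.bit1 Γ'.bit0) →
      trPosNum m.succ = (succBits l).map fun b => cond b Γ'.bit1 Γ'.bit0 := by
    intro m
    induction m with
    | one => rintro (_ | ⟨_ | _, _ | ⟨b, l⟩⟩) h <;> simp_all [trPosNum, succBits, PosNum.succ]
    | bit0 m ih => rintro (_ | ⟨_ | _, l⟩) h <;> simp_all [trPosNum, succBits, PosNum.succ]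
    | bit1 m ih =>
      rintro (_ | ⟨_ | _, l⟩) h
      · simp [trPosNum] at h
      · simp [trPosNum] at h
      · simpa [trPosNum, succBits, PosNum.succ] using ih l (by simpa [trPosNum] using h)
  induction n with
  | zero => simp [bits]
  | succ n ih =>
    have hs : ((n + 1 : ℕ) : Num) = (n : Num).succ := by rw [Nat.cast_succ, Num.add_one]
    rw [trNat] at ih ⊢
    rw [hs, bits]
    cases h : (n : Num) with
    | zero =>
      have hb : bits n = [] := by simpa [h, trNum] using ih
      rw [hb]
      rfl
    | pos m =>
      rw [h] at ih
      exact hp m _ ih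

/-! ### The grammar of a machine -/

section Grammar

variable {Q K Γ : Type} (M : StackMachine Q K Γ) (e : Letter Q K Γ → ℕ) (c : Phase Q Γ → ℕ)

/-- The linear productions for the edges of `M`, with letters and phases named by `e` and `c`, and
with the words `0 1 0` in the middle. -/
def productions : Set LinearProduction :=
  insert (c .drain, [0, 1, 0], none)
    ((fun i : Phase Q Γ × List (Letter Q K Γ) × List (Letter Q K Γ) × Phase Q Γ =>
      (c i.1, i.2.1.map e, some (c i.2.2.2, (i.2.2.1.map e).reverse))) ''
      {i | M.Edge i.1 i.2.1 i.2.2.1 i.2.2.2})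

/-- Nonterminal 0 names no phase, so the extra start production cannot occur in these derivations.
-/
theorem derivable_iff_run (hc : Function.Injective c) (hc0 : ∀ p, c p ≠ 0)
    {R : List LinearProduction} {r : List ℕ × Option (ℕ × List ℕ)}
    (hR : ∀ P, P ∈ R ↔ P ∈ M.productions e c) (p : Phase Q Γ) (z : List ℕ) :
    LinearGrammar.Derivable ((0, r) :: R) (c p) z ↔
      ∃ x y, M.Run p x y ∧ z = x.map e ++ [0, 1, 0] ++ (y.map e).reverse := by
  constructor
  · suffices ∀ A, LinearGrammar.Derivable ((0, r) :: R) A z → ∀ p, A = c p →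
        ∃ x y, M.Run p x y ∧ z = x.map e ++ [0, 1, 0] ++ (y.map e).reverse from
      fun h => this _ h p rfl
    intro A h
    induction h with
    | last h =>
      rintro p rfl
      simp only [List.mem_cons, hR, productions, Set.mem_insert_iff, Set.mem_image,
        Prod.mk.injEq, hc0, false_and, false_or, reduceCtorEq, and_false, exists_false,
        or_false, and_true] at h
      obtain ⟨hp, rfl⟩ := h
      obtain rfl := hc hp
      exact ⟨[], [], .nil, by simp⟩
    | wrap h _ ih =>
      rintro p rfl
      simp only [List.mem_cons, hR, productions, Set.mem_insert_iff, Set.mem_image,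
        Prod.mk.injEq, hc0, false_and, false_or, reduceCtorEq, and_false,
        Option.some.injEq] at h
      obtain ⟨⟨q, x, y, q'⟩, he, hp, rfl, rfl, rfl⟩ := h
      obtain rfl := hc hp
      obtain ⟨x', y', hr, rfl⟩ := ih q' rfl
      exact ⟨_, _, .cons he hr, by simp⟩
  · rintro ⟨x, y, h, rfl⟩
    induction h with
    | nil => exact .last (.tail _ ((hR _).2 (.inl rfl)))
    | @cons p x y p' x' y' he _ ih =>
      simpa using LinearGrammar.Derivable.wrap
        (.tail _ ((hR _).2 (.inr ⟨(p, x, y, p'), he, rfl⟩))) ih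

theorem exists_shuffle_mem_language_iff [DecidableEq K] (he : Function.Injective e)
    (he2 : ∀ s, 2 ≤ e s)
    (hc : Function.Injective c) (hc0 : ∀ p, c p ≠ 0) {R : List LinearProduction}
    (hR : ∀ P, P ∈ R ↔ P ∈ M.productions e c) {q : Q} {u : List (K × Option Γ)}
    {S : K → List Γ} (h : Represents u S) :
    (∃ w z : List ℕ, z ∈ shuffle w w.reverse ∧ z ∈ LinearGrammar.language
      (0, (0, [], some (c .main, ((Letter.state q :: u.map .cell ++ [Letter.sep]).map e).reverse
        ++ [1])) :: R)) ↔ M.Halts q S := by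
  rw [← M.wordHalts_iff_halts h, ← exists_run_iff]
  have hz : ∀ z, z ∈ LinearGrammar.language
      (0, (0, [], some (c .main, ((Letter.state q :: u.map .cell ++ [Letter.sep]).map e).reverse
        ++ [1])) :: R) ↔ ∃ x y, M.Run .main x y ∧ z = x.map e ++ [0, 1, 0] ++
          ((Letter.state q :: u.map .cell ++ Letter.sep :: y).map e).reverse ++ [1] := by
    intro z
    rw [LinearGrammar.mem_language_iff]
    constructor
    · rintro (h | ⟨h, hm⟩)
      · simp [hR, productions, Ne.symm (hc0 _)] at h
      · simp only [List.mem_cons, hR, productions, Set.mem_insert_iff, Set.mem_image,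
          Prod.mk.injEq, hc0, false_and, or_false, reduceCtorEq, and_false, exists_false,
          true_and, Option.some.injEq] at h
        obtain ⟨rfl, rfl, rfl⟩ := h
        obtain ⟨x, y, hr, rfl⟩ := (M.derivable_iff_run e c hc hc0 hR _ _).1 hm
        exact ⟨x, y, hr, by simp⟩
    · rintro ⟨x, y, hr, rfl⟩
      have := LinearGrammar.Derivable.wrap (.head _)
        ((M.derivable_iff_run e c hc hc0 (r := ([], some (c .main,
          ((Letter.state q :: u.map .cell ++ [Letter.sep]).map e).reverse ++ [1])))
          hR _ _).2 ⟨x, y, hr, rfl⟩)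
      simpa using this
  have hm : ∀ (i : ℕ) (x : List (Letter Q K Γ)), i < 2 → i ∉ x.map e := by
    intro i x hi hx
    obtain ⟨s, -, rfl⟩ := List.mem_map.1 hx
    exact absurd (he2 s) (by omega)
  have hm' : ∀ (i : ℕ) (x : List (Letter Q K Γ)), i < 2 → i ∉ (x.map e).reverse :=
    fun i x hi => by simpa only [List.mem_reverse] using hm i x hi
  -- The marker lemma with `e = 1` and `m = 0`; letters are named by numbers from 2 on.
  have hs : ∀ x y : List (Letter Q K Γ), (∃ w, x.map e ++ [0, 1, 0] ++ (y.map e).reverse ++ [1] ∈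
      shuffle w w.reverse) ↔ y = x := fun x y => by
    rw [exists_mem_shuffle_reverse_iff (by decide) (hm _ _ (by decide)) (hm _ _ (by decide))
      (hm' _ _ (by decide)) (hm' _ _ (by decide)), List.reverse_inj,
      (List.map_injective_iff.2 he).eq_iff]
  constructor
  · rintro ⟨w, z, hw, h⟩
    obtain ⟨x, y, hr, rfl⟩ := (hz z).1 h
    obtain rfl := (hs _ _).1 ⟨w, hw⟩
    exact ⟨y, hr⟩
  · rintro ⟨y, hr⟩
    obtain ⟨w, hw⟩ := (hs _ _).2 (rfl : Letter.state q :: u.map .cell ++ Letter.sep :: y = _)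
    exact ⟨w, _, hw, (hz _).2 ⟨_, y, hr, rfl⟩⟩

end Grammar

theorem exists_injective_letter (Q K Γ : Type) [Finite Q] [Finite K] [Finite Γ] :
    ∃ e : Letter Q K Γ → ℕ, Function.Injective e ∧ ∀ s, 2 ≤ e s := by
  obtain ⟨i, hi⟩ := Countable.exists_injective_nat (Option (Q ⊕ K × Option Γ))
  let j : Letter Q K Γ → Option (Q ⊕ K × Option Γ)
    | .state q => some (.inl q)
    | .cell c => some (.inr c)
    | .sep => none
  have hj : Function.Injective j := by
    rintro (_ | _ | _) (_ | _ | _) h <;> simp_all [j]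
  exact ⟨fun s => i (j s) + 2, fun s t h => hj (hi (by simpa using h)), fun s => Nat.le_add_left _ _⟩

theorem exists_injective_phase (Q Γ : Type) [Finite Q] [Finite Γ] :
    ∃ c : Phase Q Γ → ℕ, Function.Injective c ∧ ∀ p, c p ≠ 0 := by
  obtain ⟨i, hi⟩ := Countable.exists_injective_nat (Fin 3 ⊕ Q × Option Γ)
  let j : Phase Q Γ → Fin 3 ⊕ Q × Option Γ
    | .main => .inl 0
    | .copy => .inl 1
    | .drain => .inl 2
    | .scan q t => .inr (q, t)
  have hj : Function.Injective j := by
    rintro (_ | _ | _ | _) (_ | _ | _ | _) h <;> simp_all [j]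
  exact ⟨fun s => i (j s) + 1, fun s t h => hj (hi (by simpa using h)), fun s => Nat.succ_ne_zero _⟩

end StackMachine

open StackMachine Turing.PartrecToTM2 in
/-- It is undecidable, given a linear context-free language `L` (by a linear grammar), whether `L`
contains an element of the shuffle of `w` and its reversal, for some word `w`. -/
theorem theorem4p11 :
    ¬ ComputablePred fun G : LinearGrammar =>
      ∃ w : List ℕ, ∃ z : List ℕ, z ∈ shuffle w w.reverse ∧ z ∈ G.language := by
  intro hcomp
  let f : ℕ →. ℕ := fun n => Nat.Partrec.Code.eval (Denumerable.ofNat Nat.Partrec.Code n) 0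
  have hf : Partrec f :=
    Nat.Partrec.Code.eval_part.comp (Computable.ofNat Nat.Partrec.Code) (Computable.const 0)
  obtain ⟨Q, _, M, q, hM⟩ := exists_halts_iff_dom hf
  obtain ⟨e, he, he2⟩ := exists_injective_letter Q K' Γ'
  obtain ⟨c, hc, hc0⟩ := exists_injective_phase Q Γ'
  have hfin : (M.productions e c).Finite := (M.finite_setOf_edge.image _).insert _
  -- A list chosen noncomputably, but fixed: it does not depend on `n` and enters the reduction as a
  -- constant.
  let R : List LinearProduction := hfin.toFinset.toList
  have hR : ∀ P, P ∈ R ↔ P ∈ M.productions e c := fun P => by simp [R]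
  let d (b : Bool) : K' × Option Γ' := (.main, some (cond b Γ'.bit1 Γ'.bit0))
  let s : List (K' × Option Γ') :=
    [(.main, some Γ'.cons), (.main, none), (.rev, none), (.aux, none), (.stack, none)]
  let u (n : ℕ) : List (K' × Option Γ') := (bits n).map d ++ s
  have hu : ∀ n, Represents (u n) (K'.elim (trList [n]) [] [] []) := by
    rintro n (_ | _ | _ | _) <;>
      simp [u, d, s, trNat_eq_map_bits, K'.elim, List.filter_map, Function.comp_def]
  let G (n : ℕ) : LinearGrammar := (0, (0, [], some (c .main,
    ((Letter.state q :: (u n).map .cell ++ [Letter.sep]).map e).reverse ++ [1])) :: R)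
  have hG : Computable G := by
    have hw : Primrec fun n => (Letter.state q :: (u n).map .cell ++ [Letter.sep]).map e := by
      have hd : Primrec fun n => (bits n).map fun b => e (.cell (d b)) :=
        Primrec.list_map primrec_bits ((Primrec.dom_finite fun b => e (.cell (d b))).comp Primrec.snd).to₂
      refine (Primrec.list_cons.comp (.const (e (.state q))) (Primrec.list_append.comp hd
        (.const ((s.map fun c => e (.cell c)) ++ [e .sep])))).of_eq fun n => ?_
      simp [u, Function.comp_def]
    refine Primrec.to_comp (.pair (.const 0) (Primrec.list_cons.comp (.pair (.const 0)
      (.pair (.const []) (Primrec.option_some.comp (.pair (.const _)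
        (Primrec.list_append.comp (Primrec.list_reverse.comp hw) (.const _)))))) (.const R)))
  -- The machine simulates a universal function, so `n` is the code of a program, run on input 0.
  refine ComputablePred.halting_problem 0 (ComputablePred.computable_of_manyOneReducible
    ⟨fun k => G (Encodable.encode k), hG.comp Computable.encode, fun k => ?_⟩ hcomp)
  rw [M.exists_shuffle_mem_language_iff e c he he2 hc hc0 hR (hu _), hM]
  simp [f]
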